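/- Let $Q\in\mathbb R^{n\times n}$ be symmetric positive semidefinite, $q\in\mathbb R^n$, $G\in\mathbb R^{p\times n}$, $g\in\mathbb R^p$, let $U\subseteq\mathbb R^n$ be compact and convex (e.g. a box), and let $\mathcal K$ be either the nonpositive orthant $\mathbb R^p_-$ or $\{0\}$. Consider the convex quadratic program $$F^*=\min_{u\in U}\; F(u)=\tfrac12u^TQu+q^Tu\quad\text{s.t. } Gu+g\in\mathcal K ,$$ assumed to be feasible and to have an optimal Lagrange multiplier, i.e. a $\lambda$ in the polar cone of $\mathcal K$ with $\min_{u\in U}\big(F(u)+\langle\lambda,Gu+g\rangle\big)=F^*$. Assume that either $Q\succ0$ and $\rho=0$, or $\lambda_{\min}(Q)=0$ and $\rho>0$. Put $\mathcal L_0(u,\lambda)=F(u)+\langle\lambda,Gu+g\rangle$ and $s(u,\lambda)=0$ if $\rho=0$, and $$\mathcal L_\rho(u,\lambda)=\min_{s\in\mathcal K}\Big(F(u)+\langle\lambda,Gu+g-s\rangle+\tfrac\rho2\|Gu+g-s\|^2\Big),\qquad s(u,\lambda)=\big[Gu+g+\tfrac1\rho\lambda\big]_{\mathcal K}$$ if $\rho>0$,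 where $[\cdot]_X$ is the Euclidean projection onto $X$. Let $d_\rho(\lambda)=\min_{u\in U}\mathcal L_\rho(u,\lambda)$ and $L_d=\|G\|^2/(\lambda_{\min}(Q)+\rho\|G\|^2)$ (with the spectral norm $\|G\|$). Let $\mathcal K_d=\mathbb R^p_+$ if $Q\succ0$ and $\mathcal K=\mathbb R^p_-$, and $\mathcal K_d=\mathbb R^p$ otherwise. Let $\Lambda^*$ be the set of maximizers of $d_\rho$ over $\mathcal K_d$, and let $R_d=\min_{\lambda^*\in\Lambda^*}\|\lambda^*\|$. Let $\theta_0=0$ and $\theta_{k+1}=\frac{1+\sqrt{1+4\theta_k^2}}2$ for $k\ge0$ (so $\theta_1=1$). Let $\epsilon>0$ and $$\epsilon_{\rm in}=\frac{\epsilon\sqrt\epsilon}{8R_d\sqrt{2L_d}},\qquad k_{\rm out}=\sqrt{\frac{8L_dR_d^2}{\epsilon}},$$ and assume $k_{\rm out}\ge1$. Let $\bar u^k,\lambda^k,\mu^k$ be any sequences generated by the inexact dual fast gradient method DFGM: $\lambda^0=\mu^1=0$ and, for $k\ge1$, 1. $\bar u^k\in U$ with $0\le\mathcal L_\rho(\bar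 u^k,\mu^k)-d_\rho(\mu^k)\le\epsilon_{\rm in}$; 2. $\lambda^k=\big[\mu^k+\frac1{2L_d}\big(G\bar u^k+g-s(\bar u^k,\mu^k)\big)\big]_{\mathcal K_d}$; 3. $\mu^{k+1}=\lambda^k+\frac{\theta_k-1}{\theta_{k+1}}(\lambda^k-\lambda^{k-1})$. Then, for $k=\lfloor k_{\rm out}\rfloor$ as well as for $k=\lceil k_{\rm out}\rceil$, the average primal iterate $\hat u=\Big(\sum_{j=1}^k\theta_j\bar u^j\Big)\Big/\sum_{j=1}^k\theta_j$ is $\epsilon$-primal optimal, in the sense that $$\hat u\in U,\qquad \operatorname{dist}_{\mathcal K}(G\hat u+g)\le\frac{3\epsilon}{R_d},\qquad -3\epsilon\le F(\hat u)-F^*\le\frac{5\epsilon}4 .$$ -/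

import Mathlib

noncomputable section

/-- The nearest-point projection `[x]_X` of `x` onto `X`. -/
def metricProj {E : Type*} [NormedAddCommGroup E] (X : Set E) (x : E) : E :=
  Classical.epsilon fun y => y ∈ X ∧ ∀ z ∈ X, ‖x - y‖ ≤ ‖x - z‖

/-- On a nonempty closed set, `metricProj` is indeed a nearest point (unique if the set is convex). -/
theorem metricProj_spec {n : ℕ} {X : Set (EuclideanSpace ℝ (Fin n))} (hne : X.Nonempty)
    (hcl : IsClosed X) (x : EuclideanSpace ℝ (Fin n)) :
    metricProj X x ∈ X ∧ ∀ z ∈ X, ‖x - metricProj X x‖ ≤ ‖x - z‖ := by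
  have h : ∃ y, y ∈ X ∧ ∀ z ∈ X, ‖x - y‖ ≤ ‖x - z‖ := by
    obtain ⟨y, hy, hd⟩ := hcl.exists_infDist_eq_dist hne x
    refine ⟨y, hy, fun z hz => ?_⟩
    rw [← dist_eq_norm, ← dist_eq_norm, ← hd]
    exact Metric.infDist_le_dist_of_mem hz
  exact Classical.epsilon_spec h

/-- The two kinds of constraint cones: the nonpositive orthant and `{0}`. -/
inductive ConeKind where
  | nonpos
  | zero

/-- The cone `𝒦 ⊆ ℝ^p`. -/
def ConeKind.toSet (c : ConeKind) (p : ℕ) : Set (EuclideanSpace ℝ (Fin p)) :=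
  match c with
  | .nonpos => {x | ∀ i, x i ≤ 0}
  | .zero => {0}

/-- Data of the convex quadratic program
`min ½ uᵀQu + qᵀu` subject to `u ∈ U`, `G u + g ∈ 𝒦`. -/
structure ConvexQP (n p : ℕ) where
  Q : Matrix (Fin n) (Fin n) ℝ
  q : EuclideanSpace ℝ (Fin n)
  G : Matrix (Fin p) (Fin n) ℝ
  g : EuclideanSpace ℝ (Fin p)
  U : Set (EuclideanSpace ℝ (Fin n))
  cone : ConeKind
  posSemidef : Q.PosSemidef
  isCompact : IsCompact U
  convex : Convex ℝ U

namespace ConvexQP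

variable {n p : ℕ} (P : ConvexQP n p)

/-- The cone `𝒦`. -/
def K : Set (EuclideanSpace ℝ (Fin p)) := P.cone.toSet p

/-- The objective `F(u) = ½ uᵀQu + qᵀu`. -/
def F (u : EuclideanSpace ℝ (Fin n)) : ℝ :=
  1 / 2 * inner ℝ u (Matrix.toEuclideanLin P.Q u) + inner ℝ P.q u

/-- The constraint map `u ↦ G u + g`. -/
def con (u : EuclideanSpace ℝ (Fin n)) : EuclideanSpace ℝ (Fin p) :=
  Matrix.toEuclideanLin P.G u + P.g

/-- The feasible set `{u ∈ U | G u + g ∈ 𝒦}`. -/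
def feasibleSet : Set (EuclideanSpace ℝ (Fin n)) := {u | u ∈ P.U ∧ P.con u ∈ P.K}

/-- The optimal value `F*`. -/
def Fstar : ℝ := sInf (P.F '' P.feasibleSet)

/-- `lam` is an optimal Lagrange multiplier: it lies in the polar cone of `𝒦`, and the
minimum over `U` of the ordinary Lagrangian at `lam` is the optimal value `F*`. -/
def IsLagrangeMultiplier (lam : EuclideanSpace ℝ (Fin p)) : Prop :=
  (∀ s ∈ P.K, inner ℝ lam s ≤ 0) ∧
    sInf ((fun u => P.F u + inner ℝ lam (P.con u)) '' P.U) = P.Fstar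

/-- The ordinary (`ρ = 0`) or augmented (`ρ > 0`) Lagrangian `ℒ_ρ(u, λ)`. -/
def augLagrangian (ρ : ℝ) (u : EuclideanSpace ℝ (Fin n)) (lam : EuclideanSpace ℝ (Fin p)) : ℝ :=
  if ρ = 0 then P.F u + inner ℝ lam (P.con u)
  else sInf ((fun s => P.F u + inner ℝ lam (P.con u - s) + ρ / 2 * ‖P.con u - s‖ ^ 2) '' P.K)

/-- The slack `s(u, λ)`: `[G u + g + λ / ρ]_𝒦` if `ρ > 0`, and `0` if `ρ = 0`. -/
def slack (ρ : ℝ) (u : EuclideanSpace ℝ (Fin n)) (lam : EuclideanSpace ℝ (Fin p)) :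
    EuclideanSpace ℝ (Fin p) :=
  if ρ = 0 then 0 else metricProj P.K (P.con u + (1 / ρ) • lam)

/-- The (augmented) dual function `d_ρ(λ) = min_{u ∈ U} ℒ_ρ(u, λ)`. -/
def dual (ρ : ℝ) (lam : EuclideanSpace ℝ (Fin p)) : ℝ :=
  sInf ((fun u => P.augLagrangian ρ u lam) '' P.U)

/-- The inexact dual gradient `G u + g - s(u, μ)` computed from an approximate inner solution. -/
def inexactGrad (ρ : ℝ) (u : EuclideanSpace ℝ (Fin n)) (mu : EuclideanSpace ℝ (Fin p)) :
    EuclideanSpace ℝ (Fin p) :=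
  P.con u - P.slack ρ u mu

/-- The smallest eigenvalue of `Q`. -/
def lamMin : ℝ := sInf (spectrum ℝ P.Q)

/-- The spectral norm of `G`. -/
def normG : ℝ := ‖LinearMap.toContinuousLinearMap (Matrix.toEuclideanLin P.G)‖

/-- `L_d = ‖G‖² / (λ_min(Q) + ρ ‖G‖²)`. -/
def Ld (ρ : ℝ) : ℝ := P.normG ^ 2 / (P.lamMin + ρ * P.normG ^ 2)

/-- The dual constraint set `𝒦_d`: the nonnegative orthant if `Q ≻ 0` and `𝒦` is the nonpositive
orthant, and all of `ℝ^p` otherwise. -/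
def Kd : Set (EuclideanSpace ℝ (Fin p)) :=
  {lam | P.Q.PosDef ∧ P.cone = ConeKind.nonpos → ∀ i, 0 ≤ lam i}

/-- The set `Λ*` of maximizers of `d_ρ` over `𝒦_d`. -/
def dualOpt (ρ : ℝ) : Set (EuclideanSpace ℝ (Fin p)) :=
  {lam | lam ∈ P.Kd ∧ ∀ mu ∈ P.Kd, P.dual ρ mu ≤ P.dual ρ lam}

/-- `R_d`, the distance from `λ⁰` to `Λ*`. -/
def Rd (ρ : ℝ) (lam0 : EuclideanSpace ℝ (Fin p)) : ℝ := Metric.infDist lam0 (P.dualOpt ρ)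

/-- The admissible regularization parameters: either `Q ≻ 0` and `ρ = 0` (ordinary dual), or
`λ_min(Q) = 0` and `ρ > 0` (augmented dual). -/
def AdmissibleRho (ρ : ℝ) : Prop :=
  (P.Q.PosDef ∧ ρ = 0) ∨ (P.lamMin = 0 ∧ 0 < ρ)

end ConvexQP

/-- Nesterov's sequence `θ_{k+1} = (1 + √(1 + 4 θ_k²)) / 2`, started at `θ_0 = 0`. -/
def nesterovTheta : ℕ → ℝ
  | 0 => 0
  | k + 1 => (1 + Real.sqrt (1 + 4 * nesterovTheta k ^ 2)) / 2

theorem nesterovTheta_one : nesterovTheta 1 = 1 := by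
  norm_num [nesterovTheta]

namespace ConvexQP

variable {n p : ℕ} (P : ConvexQP n p)

/-- `(ū^k)`, `(λ^k)`, `(μ^k)` are generated by the inexact dual fast gradient method started at
`lam0`, with inner accuracy `εin`. The values `ū^0`, `μ^0` play no role. -/
structure IsDFGM (ρ εin : ℝ) (lam0 : EuclideanSpace ℝ (Fin p))
    (ubar : ℕ → EuclideanSpace ℝ (Fin n)) (lam mu : ℕ → EuclideanSpace ℝ (Fin p)) : Prop where
  lam_zero : lam 0 = lam0
  mu_one : mu 1 = lam0
  inner_mem : ∀ k, 1 ≤ k → ubar k ∈ P.U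
  inner_nonneg : ∀ k, 1 ≤ k → 0 ≤ P.augLagrangian ρ (ubar k) (mu k) - P.dual ρ (mu k)
  inner_le : ∀ k, 1 ≤ k → P.augLagrangian ρ (ubar k) (mu k) - P.dual ρ (mu k) ≤ εin
  lam_step : ∀ k, 1 ≤ k →
    lam k = metricProj P.Kd (mu k + (1 / (2 * P.Ld ρ)) • P.inexactGrad ρ (ubar k) (mu k))
  mu_step : ∀ k, 1 ≤ k →
    mu (k + 1) = lam k + ((nesterovTheta k - 1) / nesterovTheta (k + 1)) • (lam k - lam (k - 1))

/-- The inner accuracy `ε √ε / (8 R_d √(2 L_d))`. -/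
def innerAcc (ρ ε : ℝ) (lam0 : EuclideanSpace ℝ (Fin p)) : ℝ :=
  ε * Real.sqrt ε / (8 * P.Rd ρ lam0 * Real.sqrt (2 * P.Ld ρ))

/-- The (real) number of outer iterations `√(8 L_d R_d² / ε)`. -/
def kOut (ρ ε : ℝ) (lam0 : EuclideanSpace ℝ (Fin p)) : ℝ :=
  Real.sqrt (8 * P.Ld ρ * P.Rd ρ lam0 ^ 2 / ε)

end ConvexQP

/-- The `θ`-weighted average `û^k = (∑_{j=1}^k θ_j ū^j) / (∑_{j=1}^k θ_j)`. -/
def thetaAverage {n : ℕ} (ubar : ℕ → EuclideanSpace ℝ (Fin n)) (k : ℕ) :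
    EuclideanSpace ℝ (Fin n) :=
  (∑ j ∈ Finset.Icc 1 k, nesterovTheta j)⁻¹ • ∑ j ∈ Finset.Icc 1 k, nesterovTheta j • ubar j

end

/-!
Write the dual function as `d(λ) = inf (F(u) + ρ/2 ‖z‖² + ⟨λ, z⟩)` over `u ∈ U` and slacks `s`,
with residual `z = Gu + g - s`; the slack ranges over `𝒦` if `ρ > 0` and over `{0}` if `ρ = 0`.
In both cases the penalized objective is convex and gains `‖z - z'‖² / (8 L_d)` at midpoints
(`ConvexQP.penalized_midpoint_le`), through `λ_min(Q)` in one case and through `ρ` in the other.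
Hence a `δ`-approximate inner minimizer provides an affine majorant `l_j` of `d` with
`l_j(y) ≤ d(y) + L_d ‖y - μ^j‖² + 2δ` (`ConvexQP.splitLagrangian_le_dual_add`).

The accelerated projected gradient method with such an oracle satisfies, for every `y ∈ 𝒦_d`,
`∑ θ_j l_j(y) ≤ θ_k² d(λ^k) + 2δ ∑ θ_j² + L_d ‖y‖²` (`fastGradient_sum_le`), where moreover
`∑ θ_j = θ_k² ≥ (k + 1)² / 4` and `θ_j ≤ j`. As `l_j` is affine with slope the residual of `ū^j`,
the left side controls the averaged primal iterate. Three choices give the claims: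

* `y = 0` and weak duality `d ≤ F*` bound `F(û) - F*` from above;
* `y = λ* + R_d e / ‖e‖`, with `λ*` the maximizer of `d` of least norm and `e` the part of the
  averaged residual along which `𝒦_d` is unbounded (`ConvexQP.exists_recession_direction`), together
  with `l_j(λ*) ≥ d(λ*) = F*`, bounds the infeasibility;
* `λ*` is a Lagrange multiplier of the original problem (`ConvexQP.Fstar_le_of_Fstar_le_dual`), so
  `F(û) - F* ≥ -R_d dist(Gû + g, 𝒦)`.

The stated accuracies follow since `δ = ε / (4 k_out)`, `L_d R_d² = ε k_out² / 8`,
`k_out ≤ k + 1` and `k ≤ 2 k_out`.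
-/

/-! ### Nesterov's step-size sequence -/

theorem nesterovTheta_nonneg (k : ℕ) : 0 ≤ nesterovTheta k := by
  cases k with
  | zero => simp [nesterovTheta]
  | succ k => rw [nesterovTheta]; positivity

theorem nesterovTheta_succ_sq_sub (k : ℕ) :
    nesterovTheta (k + 1) ^ 2 - nesterovTheta (k + 1) = nesterovTheta k ^ 2 := by
  have h := Real.sq_sqrt (show 0 ≤ 1 + 4 * nesterovTheta k ^ 2 by positivity)
  rw [nesterovTheta]
  linear_combination h / 4

theorem nesterovTheta_succ_le (k : ℕ) : nesterovTheta (k + 1) ≤ nesterovTheta k + 1 := by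
  have h0 := nesterovTheta_nonneg k
  have : Real.sqrt (1 + 4 * nesterovTheta k ^ 2) ≤ 1 + 2 * nesterovTheta k :=
    Real.sqrt_le_iff.2 ⟨by positivity, by nlinarith⟩
  rw [nesterovTheta]
  linarith

theorem nesterovTheta_add_half_le (k : ℕ) : nesterovTheta k + 1 / 2 ≤ nesterovTheta (k + 1) := by
  have : 2 * nesterovTheta k ≤ Real.sqrt (1 + 4 * nesterovTheta k ^ 2) :=
    Real.le_sqrt_of_sq_le (by nlinarith)
  rw [nesterovTheta]
  linarith

theorem nesterovTheta_mono : Monotone nesterovTheta :=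
  monotone_nat_of_le_succ fun k => by linarith [nesterovTheta_add_half_le k]

theorem nesterovTheta_le (k : ℕ) : nesterovTheta k ≤ k := by
  induction k with
  | zero => simp [nesterovTheta]
  | succ k ih => push_cast; linarith [nesterovTheta_succ_le k]

theorem le_nesterovTheta_succ (k : ℕ) : ((k : ℝ) + 2) / 2 ≤ nesterovTheta (k + 1) := by
  induction k with
  | zero => simp [nesterovTheta_one]
  | succ k ih => push_cast; linarith [nesterovTheta_add_half_le (k + 1)]

theorem nesterovTheta_succ_pos (k : ℕ) : 0 < nesterovTheta (k + 1) :=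
  lt_of_lt_of_le (by positivity) (le_nesterovTheta_succ k)

theorem one_le_nesterovTheta_succ (k : ℕ) : 1 ≤ nesterovTheta (k + 1) :=
  nesterovTheta_one ▸ nesterovTheta_mono (by omega)

theorem sum_nesterovTheta (k : ℕ) :
    ∑ j ∈ Finset.Icc 1 k, nesterovTheta j = nesterovTheta k ^ 2 := by
  induction k with
  | zero => simp [nesterovTheta]
  | succ k ih =>
    rw [Finset.sum_Icc_succ_top (by omega), ih]
    linarith [nesterovTheta_succ_sq_sub k]

theorem sum_nesterovTheta_sq_le (k : ℕ) :
    ∑ j ∈ Finset.Icc 1 k, nesterovTheta j ^ 2 ≤ k * nesterovTheta k ^ 2 := by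
  rw [← sum_nesterovTheta, Finset.mul_sum]
  refine Finset.sum_le_sum fun j hj => ?_
  have h1 := nesterovTheta_le j
  have h2 : (j : ℝ) ≤ k := by exact_mod_cast (Finset.mem_Icc.1 hj).2
  nlinarith [nesterovTheta_nonneg j]

/-! ### Projections and the accelerated gradient estimate -/

section FastGradient

variable {E : Type*} [NormedAddCommGroup E] [InnerProductSpace ℝ E]

/-- The variational inequality characterizing nearest points of a convex set. -/
theorem inner_sub_nearest_nonpos {X : Set E} (hX : Convex ℝ X) {x y : E} (hy : y ∈ X)
    (hmin : ∀ z ∈ X, ‖x - y‖ ≤ ‖x - z‖) {z : E} (hz : z ∈ X) :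
    inner ℝ (x - y) (z - y) ≤ 0 := by
  have : Nonempty X := ⟨⟨y, hy⟩⟩
  refine (norm_eq_iInf_iff_real_inner_le_zero hX hy).1 (le_antisymm ?_ ?_) z hz
  · exact le_ciInf fun w => hmin w w.2
  · exact ciInf_le ⟨0, by rintro _ ⟨w, rfl⟩; positivity⟩ (⟨y, hy⟩ : X)

/-- A projected gradient step maximizes the linear model `y ↦ ⟪y, z⟫` minus the proximal term
`L ‖y - m‖²`, with the quadratic growth that strong concavity provides. -/
theorem prox_step_le {X : Set E} (hX : Convex ℝ X) {L : ℝ} (hL : 0 < L) {m z x : E} (hx : x ∈ X)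
    (hmin : ∀ y ∈ X, ‖m + (1 / (2 * L)) • z - x‖ ≤ ‖m + (1 / (2 * L)) • z - y‖)
    {y : E} (hy : y ∈ X) :
    inner ℝ y z - L * ‖y - m‖ ^ 2 + L * ‖y - x‖ ^ 2 ≤ inner ℝ x z - L * ‖x - m‖ ^ 2 := by
  have h := inner_sub_nearest_nonpos hX hx hmin hy
  have e : m + (1 / (2 * L)) • z - x = (1 / (2 * L)) • z - (x - m) := by abel
  rw [e, inner_sub_left, real_inner_smul_left] at h
  have h2 : inner ℝ z (y - x) ≤ 2 * L * inner ℝ (x - m) (y - x) := by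
    have := mul_le_mul_of_nonneg_left h (by positivity : 0 ≤ 2 * L)
    rw [mul_sub, ← mul_assoc, mul_one_div_cancel (by positivity)] at this
    linarith
  have e2 : ‖y - m‖ ^ 2 = ‖x - m‖ ^ 2 + 2 * inner ℝ (x - m) (y - x) + ‖y - x‖ ^ 2 := by
    rw [← norm_add_sq_real]; congr 2; abel
  rw [inner_sub_right, real_inner_comm y z, real_inner_comm x z] at h2
  rw [e2]
  linarith

/-- The estimate-sequence inequality of the accelerated projected gradient method for maximizing
`d` over `C` with an inexact oracle. The oracle returns affine majorants
`y ↦ f k + ⟪y, z k⟫` of `d` that exceed `d` by at most `L ‖y - mu k‖² + η`; the weighted sum of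
these majorants is then controlled by the value `d (lam k)`. -/
theorem fastGradient_sum_le {C : Set E} (hC : Convex ℝ C) {L η : ℝ} (hL : 0 < L)
    {d : E → ℝ} {f : ℕ → ℝ} {z lam mu : ℕ → E}
    (hlam0 : lam 0 = 0) (hmu1 : mu 1 = 0) (hmem : ∀ k, lam k ∈ C)
    (hprox : ∀ k, 1 ≤ k → ∀ y ∈ C,
      ‖mu k + (1 / (2 * L)) • z k - lam k‖ ≤ ‖mu k + (1 / (2 * L)) • z k - y‖)
    (hmu : ∀ k, 1 ≤ k → mu (k + 1) =
      lam k + ((nesterovTheta k - 1) / nesterovTheta (k + 1)) • (lam k - lam (k - 1)))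
    (hlow : ∀ k, 1 ≤ k → ∀ y, d y ≤ f k + inner ℝ y (z k))
    (hup : ∀ k, 1 ≤ k → ∀ y, f k + inner ℝ y (z k) ≤ d y + L * ‖y - mu k‖ ^ 2 + η)
    {y : E} (hy : y ∈ C) (k : ℕ) :
    ∑ j ∈ Finset.Icc 1 k, nesterovTheta j * (f j + inner ℝ y (z j)) ≤
      nesterovTheta k ^ 2 * d (lam k) + η * ∑ j ∈ Finset.Icc 1 k, nesterovTheta j ^ 2
        + L * ‖y‖ ^ 2 := by
  -- `v k` is the estimate-sequence centre; each step compares `‖y - v (k + 1)‖` with `‖y - v k‖`.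
  set v : ℕ → E := fun k => lam (k - 1) + nesterovTheta k • (lam k - lam (k - 1)) with hv
  suffices h : ∑ j ∈ Finset.Icc 1 k, nesterovTheta j * (f j + inner ℝ y (z j))
      + L * ‖y - v k‖ ^ 2 ≤
      nesterovTheta k ^ 2 * d (lam k) + η * ∑ j ∈ Finset.Icc 1 k, nesterovTheta j ^ 2
        + L * ‖y‖ ^ 2 by
    have : 0 ≤ L * ‖y - v k‖ ^ 2 := by positivity
    linarith
  induction k with
  | zero => simp [hv, hlam0, nesterovTheta]
  | succ k ih =>
    set t := nesterovTheta (k + 1) with ht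
    have ht1 : 1 ≤ t := one_le_nesterovTheta_succ k
    have ht0 : 0 < t := by linarith
    have htk : t ^ 2 - t = nesterovTheta k ^ 2 := nesterovTheta_succ_sq_sub k
    have hmuv : t • mu (k + 1) - (t - 1) • lam k = v k := by
      rcases Nat.eq_zero_or_pos k with rfl | hk
      · simp [hv, hmu1, hlam0, nesterovTheta]
      · rw [hmu k hk, smul_add, smul_smul, mul_div_cancel₀ _ ht0.ne', hv]
        module
    -- the step inequality is used at a point on the segment from the last iterate to `y`
    set c : E := t⁻¹ • y + (1 - t⁻¹) • lam k with hc
    have hti : t⁻¹ ≤ 1 := inv_le_one_of_one_le₀ ht1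
    have hcC : c ∈ C := hC hy (hmem k) (by positivity) (by linarith) (by ring)
    have e1 : t • (c - lam (k + 1)) = y - v (k + 1) := by
      simp only [hc, hv, Nat.add_sub_cancel, smul_sub, smul_add, smul_smul, mul_sub,
        mul_inv_cancel₀ ht0.ne', ← ht]
      module
    have e2 : t • (c - mu (k + 1)) = y - v k := by
      rw [← hmuv]
      simp only [hc, smul_sub, smul_add, smul_smul, mul_sub, mul_inv_cancel₀ ht0.ne']
      module
    have n1 : ‖y - v (k + 1)‖ ^ 2 = t ^ 2 * ‖c - lam (k + 1)‖ ^ 2 := by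
      rw [← e1, norm_smul, mul_pow, Real.norm_eq_abs, sq_abs]
    have n2 : ‖y - v k‖ ^ 2 = t ^ 2 * ‖c - mu (k + 1)‖ ^ 2 := by
      rw [← e2, norm_smul, mul_pow, Real.norm_eq_abs, sq_abs]
    have hp := prox_step_le hC hL (hmem (k + 1)) (hprox (k + 1) (by omega)) hcC
    have hu := hup (k + 1) (by omega) (lam (k + 1))
    have hl := hlow (k + 1) (by omega) (lam k)
    have ec : t * inner ℝ c (z (k + 1)) =
        inner ℝ y (z (k + 1)) + (t - 1) * inner ℝ (lam k) (z (k + 1)) := by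
      rw [hc, inner_add_left, real_inner_smul_left, real_inner_smul_left]
      field_simp
    have main := mul_le_mul_of_nonneg_left (add_le_add hp hu) (sq_nonneg t)
    have hl' := mul_le_mul_of_nonneg_left hl (mul_nonneg ht0.le (sub_nonneg.2 ht1))
    have ec' : t ^ 2 * inner ℝ c (z (k + 1)) =
        t * (inner ℝ y (z (k + 1)) + (t - 1) * inner ℝ (lam k) (z (k + 1))) := by
      rw [← ec]; ring
    rw [Finset.sum_Icc_succ_top (by omega), Finset.sum_Icc_succ_top (by omega), ← ht, n1]
    rw [n2, ← htk] at ih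
    nlinarith only [main, hl', ec', ih]

end FastGradient

/-! ### The quadratic program and its constraint sets -/

namespace ConvexQP

variable {n p : ℕ} (P : ConvexQP n p)

theorem lamMin_mul_norm_sq_le (x : EuclideanSpace ℝ (Fin n)) :
    P.lamMin * ‖x‖ ^ 2 ≤ inner ℝ x (Matrix.toEuclideanLin P.Q x) := by
  have hshift : (P.Q - algebraMap ℝ (Matrix (Fin n) (Fin n) ℝ) P.lamMin).PosSemidef := by
    rw [Matrix.posSemidef_iff_isHermitian_and_spectrum_nonneg]
    refine ⟨P.posSemidef.isHermitian.sub ?_, ?_⟩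
    · simp [Matrix.algebraMap_eq_diagonal]
    · rw [← spectrum.sub_singleton_eq]
      rintro _ ⟨a, ha, b, rfl, rfl⟩
      exact sub_nonneg.2 (csInf_le P.Q.finite_real_spectrum.bddBelow ha)
  have h := hshift.dotProduct_mulVec_nonneg x.ofLp
  rw [Algebra.algebraMap_eq_smul_one, Matrix.sub_mulVec, Matrix.smul_mulVec, Matrix.one_mulVec,
    dotProduct_sub, dotProduct_smul, star_trivial, smul_eq_mul] at h
  have e1 : inner ℝ x (Matrix.toEuclideanLin P.Q x) = x.ofLp ⬝ᵥ P.Q.mulVec x.ofLp := by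
    rw [EuclideanSpace.inner_eq_star_dotProduct, star_trivial, dotProduct_comm]
    rfl
  have e2 : ‖x‖ ^ 2 = x.ofLp ⬝ᵥ x.ofLp := by
    rw [← real_inner_self_eq_norm_sq, EuclideanSpace.inner_eq_star_dotProduct, star_trivial]
  rw [e1, e2]
  linarith

variable {P}

theorem lamMin_pos [Nonempty (Fin n)] (hQ : P.Q.PosDef) : 0 < P.lamMin := by
  have hr := hQ.isHermitian.spectrum_real_eq_range_eigenvalues
  have hmem : P.lamMin ∈ spectrum ℝ P.Q :=
    Set.Nonempty.csInf_mem (hr ▸ Set.range_nonempty _) P.Q.finite_real_spectrum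
  rw [hr] at hmem
  obtain ⟨i, hi⟩ := hmem
  exact hi ▸ hQ.eigenvalues_pos i

theorem nonempty_of_normG_pos (hG : 0 < P.normG) : Nonempty (Fin n) := by
  by_contra h
  rw [not_nonempty_iff] at h
  have : LinearMap.toContinuousLinearMap (Matrix.toEuclideanLin P.G) = 0 :=
    ContinuousLinearMap.ext fun x => by simp [Subsingleton.elim x 0]
  simp [normG, this] at hG

theorem lamMin_nonneg : 0 ≤ P.lamMin :=
  Real.sInf_nonneg fun _ ha =>
    (Matrix.posSemidef_iff_isHermitian_and_spectrum_nonneg.1 P.posSemidef).2 ha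

variable (P)

theorem norm_con_sub_con_le (u v : EuclideanSpace ℝ (Fin n)) :
    ‖P.con u - P.con v‖ ≤ P.normG * ‖u - v‖ := by
  have := (LinearMap.toContinuousLinearMap (Matrix.toEuclideanLin P.G)).le_opNorm (u - v)
  simpa [con, normG] using this

theorem con_combo (u v : EuclideanSpace ℝ (Fin n)) {a b : ℝ} (hab : a + b = 1) :
    P.con (a • u + b • v) = a • P.con u + b • P.con v := by
  have : P.g = a • P.g + b • P.g := by rw [← add_smul, hab, one_smul]
  simp only [con, map_add, map_smul, smul_add]
  nth_rewrite 1 [this]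
  abel

theorem con_centerMass {ι : Type*} (t : Finset ι) (w : ι → ℝ) (hw : ∑ i ∈ t, w i ≠ 0)
    (u : ι → EuclideanSpace ℝ (Fin n)) :
    P.con (t.centerMass w u) = t.centerMass w fun i => P.con (u i) := by
  simp only [con, Finset.centerMass, map_smul, map_sum, smul_add, Finset.sum_add_distrib,
    ← Finset.sum_smul, smul_smul, inv_mul_cancel₀ hw, one_smul]

/-- `F` is strongly convex with modulus the smallest eigenvalue of `Q`. -/
theorem F_combo_le (u v : EuclideanSpace ℝ (Fin n)) {a b : ℝ} (ha : 0 ≤ a) (hb : 0 ≤ b)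
    (hab : a + b = 1) :
    P.F (a • u + b • v) ≤ a * P.F u + b * P.F v - a * b * (P.lamMin / 2 * ‖u - v‖ ^ 2) := by
  have h := mul_le_mul_of_nonneg_left (P.lamMin_mul_norm_sq_le (u - v)) (mul_nonneg ha hb)
  obtain rfl : b = 1 - a := by linarith
  simp only [F, map_add, map_sub, map_smul, inner_add_left, inner_add_right, inner_sub_left,
    inner_sub_right, real_inner_smul_left, real_inner_smul_right] at h ⊢
  linarith

theorem convexOn_F : ConvexOn ℝ P.U P.F := by
  refine ⟨P.convex, fun u _ v _ a b ha hb hab => (P.F_combo_le u v ha hb hab).trans ?_⟩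
  have := P.lamMin_nonneg
  have : 0 ≤ a * b * (P.lamMin / 2 * ‖u - v‖ ^ 2) := by positivity
  simp only [smul_eq_mul]
  linarith

theorem continuous_F : Continuous P.F := by
  have : Continuous (Matrix.toEuclideanLin P.Q) := LinearMap.continuous_of_finiteDimensional _
  unfold F
  fun_prop

theorem continuous_con : Continuous P.con := by
  have : Continuous (Matrix.toEuclideanLin P.G) := LinearMap.continuous_of_finiteDimensional _
  unfold con
  fun_prop

theorem Fstar_le {u : EuclideanSpace ℝ (Fin n)} (hu : u ∈ P.feasibleSet) : P.Fstar ≤ P.F u :=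
  csInf_le ((P.isCompact.image P.continuous_F).bddBelow.mono
    (Set.image_mono fun _ h => h.1)) (Set.mem_image_of_mem _ hu)

theorem zero_mem_K : (0 : EuclideanSpace ℝ (Fin p)) ∈ P.K := by
  unfold K ConeKind.toSet
  cases P.cone <;> simp

theorem isClosed_K : IsClosed P.K := by
  unfold K ConeKind.toSet
  cases P.cone
  · simp only [Set.ofPred_forall]
    exact isClosed_iInter fun i => isClosed_le (by fun_prop) continuous_const
  · exact isClosed_singleton

theorem convex_K : Convex ℝ P.K := by
  unfold K ConeKind.toSet
  cases P.cone
  · intro x hx y hy a b ha hb _ i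
    have := mul_nonpos_of_nonneg_of_nonpos ha (hx i)
    have := mul_nonpos_of_nonneg_of_nonpos hb (hy i)
    simp only [PiLp.add_apply, PiLp.smul_apply, smul_eq_mul]
    linarith
  · exact convex_singleton 0

theorem zero_mem_Kd : (0 : EuclideanSpace ℝ (Fin p)) ∈ P.Kd := fun _ _ => le_rfl

theorem isClosed_Kd : IsClosed P.Kd := by
  simp only [Kd, Set.ofPred_forall]
  exact isClosed_iInter fun _ => isClosed_iInter fun i => isClosed_le continuous_const (by fun_prop)

theorem convex_Kd : Convex ℝ P.Kd := by
  intro x hx y hy a b ha hb _ h i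
  have := mul_nonneg ha (hx h i)
  have := mul_nonneg hb (hy h i)
  simp only [PiLp.add_apply, PiLp.smul_apply, smul_eq_mul]
  linarith

/-! ### The split Lagrangian and the dual function -/

/-- The set over which the slack variable ranges: `{0}` for the ordinary dual (`ρ = 0`), the
cone `𝒦` for the augmented dual. This treats the two dual functions uniformly. -/
def slackSet (ρ : ℝ) : Set (EuclideanSpace ℝ (Fin p)) := if ρ = 0 then {0} else P.K

/-- The part of the split Lagrangian that does not depend on the multiplier,
`F(u) + ρ/2 ‖Gu + g - s‖²`. -/
noncomputable def penalized (ρ : ℝ) (u : EuclideanSpace ℝ (Fin n))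
    (s : EuclideanSpace ℝ (Fin p)) : ℝ :=
  P.F u + ρ / 2 * ‖P.con u - s‖ ^ 2

/-- The Lagrangian `F(u) + ρ/2 ‖Gu + g - s‖² + ⟨λ, Gu + g - s⟩` as a function of both `u` and the
slack `s`; it is affine in the multiplier. -/
noncomputable def splitLagrangian (ρ : ℝ) (u : EuclideanSpace ℝ (Fin n))
    (s lam : EuclideanSpace ℝ (Fin p)) : ℝ :=
  P.penalized ρ u s + inner ℝ lam (P.con u - s)

theorem slackSet_subset_K (ρ : ℝ) : P.slackSet ρ ⊆ P.K := by
  unfold slackSet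
  split_ifs
  · exact Set.singleton_subset_iff.2 P.zero_mem_K
  · exact subset_rfl

theorem convex_slackSet (ρ : ℝ) : Convex ℝ (P.slackSet ρ) := by
  unfold slackSet
  split_ifs
  · exact convex_singleton 0
  · exact P.convex_K

theorem slack_mem (ρ : ℝ) (u : EuclideanSpace ℝ (Fin n)) (lam : EuclideanSpace ℝ (Fin p)) :
    P.slack ρ u lam ∈ P.slackSet ρ := by
  unfold slack slackSet
  split_ifs
  · rfl
  · exact (metricProj_spec ⟨0, P.zero_mem_K⟩ P.isClosed_K _).1

/-- Completing the square in the slack variable. -/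
theorem splitLagrangian_eq_sq {ρ : ℝ} (hρ : ρ ≠ 0) (u : EuclideanSpace ℝ (Fin n))
    (s lam : EuclideanSpace ℝ (Fin p)) :
    P.splitLagrangian ρ u s lam =
      P.F u + ρ / 2 * ‖P.con u + (1 / ρ) • lam - s‖ ^ 2 - ‖lam‖ ^ 2 / (2 * ρ) := by
  have e : P.con u + (1 / ρ) • lam - s = (P.con u - s) + (1 / ρ) • lam := by abel
  rw [e, norm_add_sq_real, real_inner_smul_right, norm_smul, mul_pow, Real.norm_eq_abs, sq_abs,
    splitLagrangian, penalized, real_inner_comm]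
  field_simp
  ring

theorem splitLagrangian_slack_le {ρ : ℝ} (hρ : 0 ≤ ρ) (u : EuclideanSpace ℝ (Fin n))
    {s : EuclideanSpace ℝ (Fin p)} (hs : s ∈ P.slackSet ρ) (lam : EuclideanSpace ℝ (Fin p)) :
    P.splitLagrangian ρ u (P.slack ρ u lam) lam ≤ P.splitLagrangian ρ u s lam := by
  by_cases h : ρ = 0
  · rw [slackSet, if_pos h] at hs
    rw [slack, if_pos h, Set.mem_singleton_iff.1 hs]
  · rw [slackSet, if_neg h] at hs
    rw [P.splitLagrangian_eq_sq h, P.splitLagrangian_eq_sq h, slack, if_neg h]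
    have := (metricProj_spec ⟨0, P.zero_mem_K⟩ P.isClosed_K (P.con u + (1 / ρ) • lam)).2 s hs
    gcongr

theorem augLagrangian_eq {ρ : ℝ} (hρ : 0 ≤ ρ) (u : EuclideanSpace ℝ (Fin n))
    (lam : EuclideanSpace ℝ (Fin p)) :
    P.augLagrangian ρ u lam = P.splitLagrangian ρ u (P.slack ρ u lam) lam := by
  by_cases h : ρ = 0
  · simp [augLagrangian, splitLagrangian, penalized, slack, h]
  · have e : (fun s => P.F u + inner ℝ lam (P.con u - s) + ρ / 2 * ‖P.con u - s‖ ^ 2) =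
        fun s => P.splitLagrangian ρ u s lam := by
      funext s
      simp only [splitLagrangian, penalized]
      ring
    have hS : P.slackSet ρ = P.K := by simp [slackSet, h]
    rw [augLagrangian, if_neg h, e, ← hS]
    refine IsLeast.csInf_eq ⟨Set.mem_image_of_mem _ (P.slack_mem ρ u lam), ?_⟩
    rintro _ ⟨s, hs, rfl⟩
    exact P.splitLagrangian_slack_le hρ u hs lam

theorem bddBelow_augLagrangian {ρ : ℝ} (hρ : 0 ≤ ρ) (lam : EuclideanSpace ℝ (Fin p)) :
    BddBelow ((fun u => P.augLagrangian ρ u lam) '' P.U) := by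
  by_cases h : ρ = 0
  · simp only [augLagrangian, if_pos h]
    have := P.continuous_F
    have := P.continuous_con
    exact (P.isCompact.image (by fun_prop)).bddBelow
  · obtain ⟨m, hm⟩ := (P.isCompact.image P.continuous_F).bddBelow
    refine ⟨m - ‖lam‖ ^ 2 / (2 * ρ), ?_⟩
    rintro _ ⟨u, hu, rfl⟩
    have h1 := hm (Set.mem_image_of_mem _ hu)
    have h2 : 0 ≤ ρ / 2 * ‖P.con u + (1 / ρ) • lam - P.slack ρ u lam‖ ^ 2 := by positivity
    simp only [P.augLagrangian_eq hρ, P.splitLagrangian_eq_sq h]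
    linarith

theorem dual_le {ρ : ℝ} (hρ : 0 ≤ ρ) {u : EuclideanSpace ℝ (Fin n)} (hu : u ∈ P.U)
    {s : EuclideanSpace ℝ (Fin p)} (hs : s ∈ P.slackSet ρ) (lam : EuclideanSpace ℝ (Fin p)) :
    P.dual ρ lam ≤ P.splitLagrangian ρ u s lam :=
  (csInf_le (P.bddBelow_augLagrangian hρ lam) (Set.mem_image_of_mem _ hu)).trans
    ((P.augLagrangian_eq hρ u lam).trans_le (P.splitLagrangian_slack_le hρ u hs lam))

theorem le_dual {ρ : ℝ} (hρ : 0 ≤ ρ) (hU : P.U.Nonempty) {lam : EuclideanSpace ℝ (Fin p)} {c : ℝ}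
    (h : ∀ u ∈ P.U, ∀ s ∈ P.slackSet ρ, c ≤ P.splitLagrangian ρ u s lam) :
    c ≤ P.dual ρ lam := by
  refine le_csInf (hU.image _) ?_
  rintro _ ⟨u, hu, rfl⟩
  simp only [P.augLagrangian_eq hρ]
  exact h u hu _ (P.slack_mem ρ u lam)

variable {P}

theorem AdmissibleRho.nonneg {ρ : ℝ} (hρ : P.AdmissibleRho ρ) : 0 ≤ ρ := by
  rcases hρ with ⟨_, h⟩ | ⟨_, h⟩
  · exact h.ge
  · exact h.le

/-- Along the residual `Gu + g - s`, the split Lagrangian is strongly convex with modulus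
`1 / L_d`, whichever of the two regularizations is in force. -/
theorem penalized_midpoint_le {ρ : ℝ} (hρ : P.AdmissibleRho ρ) (hG : 0 < P.normG)
    (u v : EuclideanSpace ℝ (Fin n)) {s t : EuclideanSpace ℝ (Fin p)}
    (hs : s ∈ P.slackSet ρ) (ht : t ∈ P.slackSet ρ) :
    P.penalized ρ ((1 / 2 : ℝ) • u + (1 / 2 : ℝ) • v) ((1 / 2 : ℝ) • s + (1 / 2 : ℝ) • t)
      + ‖(P.con v - t) - (P.con u - s)‖ ^ 2 / (8 * P.Ld ρ)
      ≤ (P.penalized ρ u s + P.penalized ρ v t) / 2 := by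
  have hF := P.F_combo_le u v (a := 1 / 2) (b := 1 / 2) (by norm_num) (by norm_num) (by norm_num)
  have e : P.con ((1 / 2 : ℝ) • u + (1 / 2 : ℝ) • v) - ((1 / 2 : ℝ) • s + (1 / 2 : ℝ) • t) =
      (1 / 2 : ℝ) • ((P.con v - t) + (P.con u - s)) := by
    rw [P.con_combo u v (by norm_num)]
    module
  have e2 : ‖(1 / 2 : ℝ) • ((P.con v - t) + (P.con u - s))‖ ^ 2 =
      (‖P.con u - s‖ ^ 2 + ‖P.con v - t‖ ^ 2) / 2
        - ‖(P.con v - t) - (P.con u - s)‖ ^ 2 / 4 := by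
    rw [norm_smul, mul_pow, norm_add_sq_real,
      norm_sub_sq_real (P.con v - t) (P.con u - s)]
    norm_num
    ring
  simp only [penalized, e, e2]
  rcases hρ with ⟨hQ, rfl⟩ | ⟨h0, hpos⟩
  · have : Nonempty (Fin n) := nonempty_of_normG_pos hG
    have hl := lamMin_pos hQ
    simp only [slackSet, if_true, Set.mem_singleton_iff] at hs ht
    subst hs ht
    have hb : ‖P.con v - P.con u‖ ^ 2 ≤ P.normG ^ 2 * ‖u - v‖ ^ 2 := by
      rw [← mul_pow, norm_sub_rev u v]
      exact pow_le_pow_left₀ (norm_nonneg _) (P.norm_con_sub_con_le v u) 2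
    have : ‖P.con v - P.con u‖ ^ 2 / (8 * P.Ld 0) ≤ P.lamMin / 8 * ‖u - v‖ ^ 2 := by
      rw [div_le_iff₀ (by unfold Ld; positivity)]
      calc _ ≤ P.normG ^ 2 * ‖u - v‖ ^ 2 := hb
        _ = _ := by unfold Ld; field_simp; ring
    simp only [sub_zero]
    linarith
  · have : P.Ld ρ = 1 / ρ := by unfold Ld; rw [h0]; field_simp; ring
    rw [this]
    rw [h0] at hF
    have e3 : ∀ x : ℝ, x / (8 * (1 / ρ)) = ρ / 8 * x := fun x => by field_simp
    rw [e3]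
    linarith

/-- The inexact oracle: a `δ`-approximate inner minimizer gives an affine majorant of the dual
function that is tight up to `L_d ‖y - λ‖² + 2δ`. Comparing the two primal points through
their midpoint avoids the exact inner minimizer and the gradient of the dual. -/
theorem splitLagrangian_le_dual_add {ρ : ℝ} (hρ : P.AdmissibleRho ρ) (hG : 0 < P.normG)
    (hL : 0 < P.Ld ρ) {u : EuclideanSpace ℝ (Fin n)} (hu : u ∈ P.U)
    {s : EuclideanSpace ℝ (Fin p)} (hs : s ∈ P.slackSet ρ) {lam : EuclideanSpace ℝ (Fin p)} {δ : ℝ}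
    (hδ : P.splitLagrangian ρ u s lam ≤ P.dual ρ lam + δ) (y : EuclideanSpace ℝ (Fin p)) :
    P.splitLagrangian ρ u s y ≤ P.dual ρ y + P.Ld ρ * ‖y - lam‖ ^ 2 + 2 * δ := by
  suffices h : P.splitLagrangian ρ u s y - P.Ld ρ * ‖y - lam‖ ^ 2 - 2 * δ ≤ P.dual ρ y by linarith
  refine P.le_dual hρ.nonneg ⟨u, hu⟩ fun v hv t ht => ?_
  have hm := P.dual_le hρ.nonneg (P.convex hu hv (a := 1 / 2) (b := 1 / 2) (by norm_num)
    (by norm_num) (by norm_num)) (P.convex_slackSet ρ hs ht (a := 1 / 2) (b := 1 / 2) (by norm_num)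
    (by norm_num) (by norm_num)) lam
  have hp := penalized_midpoint_le hρ hG u v hs ht
  have e : P.con ((1 / 2 : ℝ) • u + (1 / 2 : ℝ) • v) - ((1 / 2 : ℝ) • s + (1 / 2 : ℝ) • t) =
      (1 / 2 : ℝ) • (P.con u - s) + (1 / 2 : ℝ) • (P.con v - t) := by
    rw [P.con_combo u v (by norm_num)]
    module
  set w := (P.con v - t) - (P.con u - s) with hw
  have hcs : -(‖y - lam‖ * ‖w‖) ≤ inner ℝ (y - lam) w :=
    (abs_le.1 (abs_real_inner_le_norm _ _)).1
  have hsq : ‖y - lam‖ * ‖w‖ ≤ ‖w‖ ^ 2 / (4 * P.Ld ρ) + P.Ld ρ * ‖y - lam‖ ^ 2 := by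
    have e3 : ‖w‖ ^ 2 / (4 * P.Ld ρ) + P.Ld ρ * ‖y - lam‖ ^ 2 - ‖y - lam‖ * ‖w‖ =
        (‖w‖ - 2 * P.Ld ρ * ‖y - lam‖) ^ 2 / (4 * P.Ld ρ) := by
      field_simp
      ring
    have : 0 ≤ (‖w‖ - 2 * P.Ld ρ * ‖y - lam‖) ^ 2 / (4 * P.Ld ρ) := by positivity
    linarith
  have e4 : ‖w‖ ^ 2 / (4 * P.Ld ρ) = 2 * (‖w‖ ^ 2 / (8 * P.Ld ρ)) := by
    field_simp
    ring
  simp only [splitLagrangian, e, inner_add_right, real_inner_smul_right] at hm hδ ⊢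
  simp only [hw, inner_sub_left, inner_sub_right] at hcs
  simp only [inner_sub_right] at hm hδ ⊢
  linarith

/-! ### Strong duality -/

theorem dual_le_Fstar {ρ : ℝ} (hρ : P.AdmissibleRho ρ) (hfeas : P.feasibleSet.Nonempty)
    {lam : EuclideanSpace ℝ (Fin p)} (hlam : lam ∈ P.Kd) : P.dual ρ lam ≤ P.Fstar := by
  refine le_csInf (hfeas.image _) ?_
  rintro _ ⟨u, ⟨hu, hcon⟩, rfl⟩
  by_cases h : ρ = 0
  · have hQ : P.Q.PosDef := by
      rcases hρ with ⟨hQ, _⟩ | ⟨_, hpos⟩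
      · exact hQ
      · exact absurd h hpos.ne'
    refine (P.dual_le hρ.nonneg hu (s := 0) (by simp [slackSet, h]) lam).trans ?_
    suffices inner ℝ lam (P.con u) ≤ 0 by simpa [splitLagrangian, penalized, h] using this
    cases hc : P.cone
    · simp only [K, hc, ConeKind.toSet, Set.mem_ofPred_eq] at hcon
      rw [PiLp.inner_apply]
      exact Finset.sum_nonpos fun i _ => by
        simpa [mul_comm] using mul_nonpos_of_nonneg_of_nonpos (hlam ⟨hQ, hc⟩ i) (hcon i)
    · simp only [K, hc, ConeKind.toSet, Set.mem_singleton_iff] at hcon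
      simp [hcon]
  · refine (P.dual_le hρ.nonneg hu (s := P.con u) (by simpa [slackSet, h] using hcon) lam).trans ?_
    simp [splitLagrangian, penalized]

theorem IsLagrangeMultiplier.mem_Kd {lam : EuclideanSpace ℝ (Fin p)}
    (h : P.IsLagrangeMultiplier lam) : lam ∈ P.Kd := by
  rintro ⟨_, hc⟩ i
  have := h.1 (EuclideanSpace.single i (-1)) (by
    simp only [K, hc, ConeKind.toSet, Set.mem_ofPred_eq]
    intro j
    by_cases hj : j = i <;> simp [hj])
  simpa [EuclideanSpace.inner_single_right] using this

theorem IsLagrangeMultiplier.Fstar_le_dual {ρ : ℝ} (hρ : 0 ≤ ρ) (hU : P.U.Nonempty)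
    {lam : EuclideanSpace ℝ (Fin p)} (h : P.IsLagrangeMultiplier lam) :
    P.Fstar ≤ P.dual ρ lam := by
  refine P.le_dual hρ hU fun u hu s hs => ?_
  have h1 := h.1 s (P.slackSet_subset_K ρ hs)
  have hc : Continuous fun u => P.F u + inner ℝ lam (P.con u) := by
    have := P.continuous_F
    have := P.continuous_con
    fun_prop
  have h2 : P.Fstar ≤ P.F u + inner ℝ lam (P.con u) := h.2 ▸
    csInf_le (P.isCompact.image hc).bddBelow (Set.mem_image_of_mem _ hu)
  have h3 : 0 ≤ ρ / 2 * ‖P.con u - s‖ ^ 2 := by positivity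
  simp only [splitLagrangian, penalized, inner_sub_right]
  linarith

/-- A maximizer of the dual function is a Lagrange multiplier for the original problem. In the
augmented case the quadratic penalty is removed by moving from a feasible point towards `(u, s)`
by a small step `τ`: the penalty decreases like `τ²`, everything else like `τ`. -/
theorem Fstar_le_of_Fstar_le_dual {ρ : ℝ} (hρ : P.AdmissibleRho ρ) (hfeas : P.feasibleSet.Nonempty)
    {lam : EuclideanSpace ℝ (Fin p)} (hlam : lam ∈ P.Kd) (hd : P.Fstar ≤ P.dual ρ lam)
    {u : EuclideanSpace ℝ (Fin n)} (hu : u ∈ P.U) {s : EuclideanSpace ℝ (Fin p)} (hs : s ∈ P.K) :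
    P.Fstar ≤ P.F u + inner ℝ lam (P.con u - s) := by
  rcases hρ with ⟨hQ, rfl⟩ | ⟨h0, hpos⟩
  · have h1 := hd.trans (P.dual_le le_rfl hu (s := 0) (by simp [slackSet]) lam)
    simp only [splitLagrangian, penalized, zero_div, zero_mul, add_zero, sub_zero] at h1
    suffices inner ℝ lam s ≤ 0 by
      rw [inner_sub_right]
      linarith
    cases hc : P.cone
    · simp only [K, hc, ConeKind.toSet, Set.mem_ofPred_eq] at hs
      rw [PiLp.inner_apply]
      exact Finset.sum_nonpos fun i _ => by
        simpa [mul_comm] using mul_nonpos_of_nonneg_of_nonpos (hlam ⟨hQ, hc⟩ i) (hs i)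
    · simp only [K, hc, ConeKind.toSet, Set.mem_singleton_iff] at hs
      simp [hs]
  · set c := ρ / 2 * ‖P.con u - s‖ ^ 2 with hc
    have hS : P.slackSet ρ = P.K := by simp [slackSet, hpos.ne']
    have key : ∀ τ ∈ Set.Ioo (0 : ℝ) 1,
        P.Fstar ≤ P.F u + inner ℝ lam (P.con u - s) + τ * c := by
      rintro τ ⟨hτ0, hτ1⟩
      have h1 : (P.Fstar - τ * (P.F u + inner ℝ lam (P.con u - s) + τ * c)) / (1 - τ) ≤
          P.Fstar := by
        refine le_csInf (hfeas.image _) ?_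
        rintro _ ⟨x, ⟨hx, hxK⟩, rfl⟩
        rw [div_le_iff₀ (by linarith)]
        have hF := P.F_combo_le x u (a := 1 - τ) (b := τ) (by linarith) hτ0.le (by ring)
        have hdl := hd.trans (P.dual_le hpos.le
          (P.convex hx hu (a := 1 - τ) (b := τ) (by linarith) hτ0.le (by ring))
          (P.convex_slackSet ρ (hS ▸ hxK) (hS ▸ hs) (a := 1 - τ) (b := τ) (by linarith) hτ0.le
            (by ring)) lam)
        have e : P.con ((1 - τ) • x + τ • u) - ((1 - τ) • P.con x + τ • s) =
            τ • (P.con u - s) := by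
          rw [P.con_combo x u (by ring)]
          module
        rw [splitLagrangian, penalized, e, norm_smul, mul_pow, Real.norm_eq_abs, sq_abs,
          real_inner_smul_right] at hdl
        rw [h0] at hF
        rw [hc]
        linarith
      rw [div_le_iff₀ (by linarith)] at h1
      have h2 : τ * P.Fstar ≤ τ * (P.F u + inner ℝ lam (P.con u - s) + τ * c) := by linarith
      exact le_of_mul_le_mul_left h2 hτ0
    have hc0 : 0 ≤ c := by positivity
    refine le_of_forall_pos_le_add fun η hη => ?_
    have hτ : η / (η + c + 1) ∈ Set.Ioo (0 : ℝ) 1 :=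
      ⟨by positivity, by rw [div_lt_one (by positivity)]; linarith⟩
    have : η / (η + c + 1) * c ≤ η := by
      rw [div_mul_eq_mul_div, div_le_iff₀ (by positivity)]
      nlinarith
    linarith [key _ hτ]

theorem isClosed_dualOpt {ρ : ℝ} (hρ : 0 ≤ ρ) (hU : P.U.Nonempty) : IsClosed (P.dualOpt ρ) := by
  have e : P.dualOpt ρ = P.Kd ∩ ⋂ mu ∈ P.Kd, ⋂ u ∈ P.U, ⋂ s ∈ P.slackSet ρ,
      {lam | P.dual ρ mu ≤ P.splitLagrangian ρ u s lam} := by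
    ext lam
    simp only [dualOpt, Set.mem_ofPred_eq, Set.mem_inter_iff, Set.mem_iInter]
    refine and_congr_right fun _ => forall₂_congr fun mu _ => ?_
    exact ⟨fun h u hu s hs => h.trans (P.dual_le hρ hu hs lam), fun h => P.le_dual hρ hU h⟩
  rw [e]
  refine P.isClosed_Kd.inter (isClosed_biInter fun mu _ => isClosed_biInter fun u _ =>
    isClosed_biInter fun s _ => isClosed_le continuous_const ?_)
  unfold splitLagrangian
  fun_prop

/-- Every residual has a component `e` that is a recession direction of the dual feasible set and
whose length dominates the infeasibility. -/
theorem exists_recession_direction {ρ : ℝ} (hρ : P.AdmissibleRho ρ) (hG : 0 < P.normG)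
    (u : EuclideanSpace ℝ (Fin n)) {s : EuclideanSpace ℝ (Fin p)} (hs : s ∈ P.slackSet ρ) :
    ∃ e : EuclideanSpace ℝ (Fin p), (∀ lam ∈ P.Kd, ∀ t : ℝ, 0 ≤ t → lam + t • e ∈ P.Kd) ∧
      inner ℝ e (P.con u - s) = ‖e‖ ^ 2 ∧ Metric.infDist (P.con u) P.K ≤ ‖e‖ := by
  by_cases h : P.Q.PosDef ∧ P.cone = ConeKind.nonpos
  · -- here `ρ = 0`, hence `s = 0`, and `e` is the positive part of the residual
    have hn : Nonempty (Fin n) := nonempty_of_normG_pos hG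
    have hs0 : s = 0 := by
      rcases hρ with ⟨_, rfl⟩ | ⟨h0, _⟩
      · simpa [slackSet] using hs
      · exact absurd h0 (lamMin_pos h.1).ne'
    subst hs0
    refine ⟨WithLp.toLp 2 fun i => max (P.con u i) 0, fun lam hlam t ht _ i => ?_, ?_, ?_⟩
    · have := hlam h i
      simp only [PiLp.add_apply, PiLp.smul_apply, smul_eq_mul]
      positivity
    · rw [← real_inner_self_eq_norm_sq, PiLp.inner_apply, PiLp.inner_apply]
      refine Finset.sum_congr rfl fun i _ => ?_
      rcases le_total (P.con u i) 0 with hi | hi <;> simp [hi]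
    · have hK : P.con u - WithLp.toLp 2 (fun i => max (P.con u i) 0) ∈ P.K := by
        simp only [K, h.2, ConeKind.toSet, Set.mem_ofPred_eq]
        intro i
        simp
      refine (Metric.infDist_le_dist_of_mem hK).trans_eq ?_
      rw [dist_eq_norm, sub_sub_cancel]
  · refine ⟨P.con u - s, fun _ _ _ _ h' => absurd h' h, real_inner_self_eq_norm_sq _, ?_⟩
    rw [← dist_eq_norm]
    exact Metric.infDist_le_dist_of_mem (P.slackSet_subset_K ρ hs)

end ConvexQP

/-! ### Accuracy of the averaged primal iterate -/

namespace ConvexQP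

variable {n p : ℕ} {P : ConvexQP n p}

/-- The estimate-sequence inequality for the dual method, with weak duality used for the last
dual value. The inner errors add up to at most `2 δ k θ_k² ≤ ε θ_k²`, as `θ_j ≤ k` for `j ≤ k`. -/
theorem sum_splitLagrangian_le {ρ ε : ℝ} (hρ : P.AdmissibleRho ρ) (hG : 0 < P.normG)
    (hL : 0 < P.Ld ρ) {δ : ℝ} {ubar : ℕ → EuclideanSpace ℝ (Fin n)}
    {lam mu : ℕ → EuclideanSpace ℝ (Fin p)} (hrun : P.IsDFGM ρ δ 0 ubar lam mu)
    (hfeas : P.feasibleSet.Nonempty) {k : ℕ} (hδ0 : 0 ≤ δ) (hδ : 2 * δ * k ≤ ε)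
    {y : EuclideanSpace ℝ (Fin p)} (hy : y ∈ P.Kd) :
    ∑ j ∈ Finset.Icc 1 k, nesterovTheta j *
        P.splitLagrangian ρ (ubar j) (P.slack ρ (ubar j) (mu j)) y ≤
      nesterovTheta k ^ 2 * (P.Fstar + ε) + P.Ld ρ * ‖y‖ ^ 2 := by
  have hproj := metricProj_spec ⟨0, P.zero_mem_Kd⟩ P.isClosed_Kd
  have hmem : ∀ k, lam k ∈ P.Kd := by
    intro k
    rcases Nat.eq_zero_or_pos k with rfl | hk
    · exact hrun.lam_zero ▸ P.zero_mem_Kd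
    · exact hrun.lam_step k hk ▸ (hproj _).1
  have h := fastGradient_sum_le P.convex_Kd hL (d := P.dual ρ) (η := 2 * δ)
    (f := fun j => P.penalized ρ (ubar j) (P.slack ρ (ubar j) (mu j)))
    (z := fun j => P.inexactGrad ρ (ubar j) (mu j)) hrun.lam_zero hrun.mu_one hmem
    (fun k hk y hy => hrun.lam_step k hk ▸ (hproj _).2 y hy) hrun.mu_step
    (fun k hk y => P.dual_le hρ.nonneg (hrun.inner_mem k hk) (P.slack_mem ρ _ _) y)
    (fun k hk y => splitLagrangian_le_dual_add hρ hG hL (hrun.inner_mem k hk) (P.slack_mem ρ _ _)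
      (by rw [← P.augLagrangian_eq hρ.nonneg]; linarith [hrun.inner_le k hk]) y) hy k
  refine h.trans (add_le_add_left ?_ _)
  have h1 := mul_le_mul_of_nonneg_left (dual_le_Fstar hρ hfeas (hmem k))
    (sq_nonneg (nesterovTheta k))
  have h2 := mul_le_mul_of_nonneg_left (sum_nesterovTheta_sq_le k)
    (by positivity : 0 ≤ 2 * δ)
  have h3 := mul_le_mul_of_nonneg_right hδ (sq_nonneg (nesterovTheta k))
  linarith

theorem thetaAverage_eq_centerMass (ubar : ℕ → EuclideanSpace ℝ (Fin n)) (k : ℕ) :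
    thetaAverage ubar k = (Finset.Icc 1 k).centerMass nesterovTheta ubar := rfl

/-- With `4 L_d R² ≤ 2 ε θ_k²` and `2 δ k ≤ ε`, the averaged primal iterate is nearly optimal,
its infeasibility being measured against any dual maximizer of norm `R`. -/
theorem thetaAverage_accuracy {ρ ε : ℝ} (hρ : P.AdmissibleRho ρ) (hG : 0 < P.normG)
    (hL : 0 < P.Ld ρ) {δ : ℝ} {ubar : ℕ → EuclideanSpace ℝ (Fin n)}
    {lam mu : ℕ → EuclideanSpace ℝ (Fin p)} (hrun : P.IsDFGM ρ δ 0 ubar lam mu)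
    (hfeas : P.feasibleSet.Nonempty) {k : ℕ} (hk : 1 ≤ k) (hδ0 : 0 ≤ δ) (hδ : 2 * δ * k ≤ ε)
    {y : EuclideanSpace ℝ (Fin p)} (hy : y ∈ P.Kd) (hyd : P.Fstar ≤ P.dual ρ y)
    (hyR : 0 < ‖y‖) (hS : 4 * P.Ld ρ * ‖y‖ ^ 2 ≤ 2 * ε * nesterovTheta k ^ 2) :
    thetaAverage ubar k ∈ P.U ∧
      ‖y‖ * Metric.infDist (P.con (thetaAverage ubar k)) P.K ≤ 3 * ε ∧
      -(3 * ε) ≤ P.F (thetaAverage ubar k) - P.Fstar ∧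
      P.F (thetaAverage ubar k) - P.Fstar ≤ ε := by
  obtain ⟨m, rfl⟩ : ∃ m, k = m + 1 := ⟨k - 1, by omega⟩
  set S := nesterovTheta (m + 1) ^ 2 with hSdef
  set I := Finset.Icc 1 (m + 1) with hI
  have hS0 : 0 < S := pow_pos (nesterovTheta_succ_pos m) 2
  have hsum : ∑ j ∈ I, nesterovTheta j = S := sum_nesterovTheta (m + 1)
  have hw0 : ∀ j ∈ I, 0 ≤ nesterovTheta j := fun j _ => nesterovTheta_nonneg j
  have hwpos : 0 < ∑ j ∈ I, nesterovTheta j := hsum ▸ hS0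
  have hIU : ∀ j ∈ I, ubar j ∈ P.U := fun j hj => hrun.inner_mem j (Finset.mem_Icc.1 hj).1
  rw [thetaAverage_eq_centerMass, ← hI]
  set u := I.centerMass nesterovTheta ubar with hu
  set s := I.centerMass nesterovTheta (fun j => P.slack ρ (ubar j) (mu j)) with hs
  have huU : u ∈ P.U := P.convex.centerMass_mem hw0 hwpos hIU
  have hsS : s ∈ P.slackSet ρ :=
    (P.convex_slackSet ρ).centerMass_mem hw0 hwpos fun j _ => P.slack_mem ρ _ _
  have hz : S • (P.con u - s) =
      ∑ j ∈ I, nesterovTheta j • (P.con (ubar j) - P.slack ρ (ubar j) (mu j)) := by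
    rw [hu, hs, P.con_centerMass _ _ hwpos.ne', Finset.centerMass, Finset.centerMass, ← smul_sub,
      hsum, smul_smul, mul_inv_cancel₀ hS0.ne', one_smul, ← Finset.sum_sub_distrib]
    simp only [smul_sub]
  have hFu : S * P.F u ≤ ∑ j ∈ I, nesterovTheta j * P.F (ubar j) := by
    have := P.convexOn_F.map_centerMass_le hw0 hwpos hIU
    rw [← hu, Finset.centerMass, hsum, smul_eq_mul, ← div_eq_inv_mul, le_div_iff₀ hS0] at this
    simpa [mul_comm] using this
  -- the multiplier `0` bounds the objective
  have hupper : P.F u - P.Fstar ≤ ε := by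
    have h := sum_splitLagrangian_le hρ hG hL hrun hfeas hδ0 hδ P.zero_mem_Kd
    have h2 : ∑ j ∈ I, nesterovTheta j * P.F (ubar j) ≤ ∑ j ∈ I, nesterovTheta j *
        P.splitLagrangian ρ (ubar j) (P.slack ρ (ubar j) (mu j)) 0 := by
      refine Finset.sum_le_sum fun j hj => mul_le_mul_of_nonneg_left ?_ (hw0 j hj)
      have := hρ.nonneg
      simp only [splitLagrangian, penalized, inner_zero_left, add_zero]
      exact le_add_of_nonneg_right (by positivity)
    have h3 : S * P.F u ≤ S * (P.Fstar + ε) := by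
      rw [norm_zero] at h
      linarith
    linarith [le_of_mul_le_mul_left h3 hS0]
  -- the multiplier `y`, moved a distance `‖y‖` along the residual, bounds the infeasibility
  have hinf : ‖y‖ * Metric.infDist (P.con u) P.K ≤ 3 * ε := by
    obtain ⟨e, heK, hein, hedist⟩ := exists_recession_direction hρ hG u hsS
    refine (mul_le_mul_of_nonneg_left hedist hyR.le).trans ?_
    rcases (norm_nonneg e).eq_or_lt' with he | he
    · have : 0 ≤ 2 * δ * ((m + 1 : ℕ) : ℝ) := by positivity
      rw [he]
      linarith
    set t := ‖y‖ / ‖e‖ with ht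
    have ht0 : 0 ≤ t := by positivity
    have h := sum_splitLagrangian_le hρ hG hL hrun hfeas hδ0 hδ (heK y hy t ht0)
    have h2 : ∑ j ∈ I, nesterovTheta j *
          P.splitLagrangian ρ (ubar j) (P.slack ρ (ubar j) (mu j)) (y + t • e) =
        ∑ j ∈ I, nesterovTheta j *
          P.splitLagrangian ρ (ubar j) (P.slack ρ (ubar j) (mu j)) y + S * (‖y‖ * ‖e‖) := by
      have h3 : S * (‖y‖ * ‖e‖) = inner ℝ (t • e) (S • (P.con u - s)) := by
        rw [real_inner_smul_left, real_inner_smul_right, hein, ht]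
        field_simp
      rw [h3, hz, inner_sum, ← Finset.sum_add_distrib]
      refine Finset.sum_congr rfl fun j _ => ?_
      rw [real_inner_smul_right, splitLagrangian, splitLagrangian, inner_add_left]
      ring
    have h4 : S * P.Fstar ≤ ∑ j ∈ I, nesterovTheta j *
        P.splitLagrangian ρ (ubar j) (P.slack ρ (ubar j) (mu j)) y := by
      rw [← hsum, Finset.sum_mul]
      exact Finset.sum_le_sum fun j hj => mul_le_mul_of_nonneg_left
        (hyd.trans (P.dual_le hρ.nonneg (hIU j hj) (P.slack_mem ρ _ _) y)) (hw0 j hj)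
    have h5 : ‖y + t • e‖ ^ 2 ≤ 4 * ‖y‖ ^ 2 := by
      have : ‖y + t • e‖ ≤ 2 * ‖y‖ := by
        refine (norm_add_le _ _).trans_eq ?_
        rw [norm_smul, Real.norm_eq_abs, abs_of_nonneg ht0, ht, div_mul_cancel₀ _ he.ne']
        ring
      calc _ ≤ (2 * ‖y‖) ^ 2 := pow_le_pow_left₀ (norm_nonneg _) this 2
        _ = _ := by ring
    have h6 := mul_le_mul_of_nonneg_left h5 hL.le
    have h7 : S * (‖y‖ * ‖e‖) ≤ S * (3 * ε) := by linarith
    exact le_of_mul_le_mul_left h7 hS0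
  refine ⟨huU, hinf, ?_, hupper⟩
  obtain ⟨a, haK, ha⟩ := P.isClosed_K.exists_infDist_eq_dist ⟨0, P.zero_mem_K⟩ (P.con u)
  have h1 := Fstar_le_of_Fstar_le_dual hρ hfeas hy hyd huU haK
  have h2 := real_inner_le_norm y (P.con u - a)
  rw [ha, dist_eq_norm] at hinf
  linarith

theorem pos_of_one_le_kOut {ρ ε : ℝ} (hρ : P.AdmissibleRho ρ) (hk1 : 1 ≤ P.kOut ρ ε 0) :
    0 < P.normG ∧ 0 < P.Ld ρ ∧ 0 < P.Rd ρ 0 := by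
  have hL0 : 0 ≤ P.Ld ρ := by
    have := P.lamMin_nonneg
    have := hρ.nonneg
    unfold Ld
    positivity
  have hne : 8 * P.Ld ρ * P.Rd ρ 0 ^ 2 / ε ≠ 0 := fun h => by
    norm_num [kOut, h] at hk1
  have hL : P.Ld ρ ≠ 0 := fun h => hne (by simp [h])
  have hR : P.Rd ρ 0 ≠ 0 := fun h => hne (by simp [h])
  have hG : P.normG ≠ 0 := fun h => hL (by simp [Ld, h])
  exact ⟨(norm_nonneg _).lt_of_ne' hG, hL0.lt_of_ne' hL, Metric.infDist_nonneg.lt_of_ne' hR⟩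

theorem innerAcc_eq {ρ ε : ℝ} (hε : 0 < ε) (hL : 0 < P.Ld ρ) (hR : 0 < P.Rd ρ 0) :
    P.innerAcc ρ ε 0 = ε / (4 * P.kOut ρ ε 0) := by
  have e : P.kOut ρ ε 0 = 2 * P.Rd ρ 0 * Real.sqrt (2 * P.Ld ρ) / Real.sqrt ε := by
    rw [kOut, Real.sqrt_eq_iff_mul_self_eq (by positivity) (by positivity)]
    have h1 := Real.mul_self_sqrt (show 0 ≤ 2 * P.Ld ρ by positivity)
    have h2 := Real.mul_self_sqrt hε.le
    rw [div_mul_div_comm, h2]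
    congr 1
    linear_combination -4 * P.Rd ρ 0 ^ 2 * h1
  rw [innerAcc, e]
  have := Real.sqrt_pos.2 hε
  have := Real.sqrt_pos.2 (show 0 < 2 * P.Ld ρ by positivity)
  field_simp
  norm_num

end ConvexQP

theorem mainTheorem4 {n p : ℕ} (P : ConvexQP n p)
    (hfeas : P.feasibleSet.Nonempty)
    (hmult : ∃ lam, P.IsLagrangeMultiplier lam)
    (ρ : ℝ) (hρ : P.AdmissibleRho ρ)
    (ε : ℝ) (hε : 0 < ε)
    (hk1 : 1 ≤ P.kOut ρ ε 0)
    (ubar : ℕ → EuclideanSpace ℝ (Fin n)) (lam mu : ℕ → EuclideanSpace ℝ (Fin p))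
    (hrun : P.IsDFGM ρ (P.innerAcc ρ ε 0) 0 ubar lam mu)
    (k : ℕ) (hk : k = ⌊P.kOut ρ ε 0⌋₊ ∨ k = ⌈P.kOut ρ ε 0⌉₊) :
    thetaAverage ubar k ∈ P.U ∧
      Metric.infDist (P.con (thetaAverage ubar k)) P.K ≤ 3 * ε / P.Rd ρ 0 ∧
      -(3 * ε) ≤ P.F (thetaAverage ubar k) - P.Fstar ∧
      P.F (thetaAverage ubar k) - P.Fstar ≤ 5 * ε / 4 := by
  obtain ⟨hG, hL, hR⟩ := ConvexQP.pos_of_one_le_kOut hρ hk1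
  have hU : P.U.Nonempty := hfeas.imp fun _ h => h.1
  -- `R_d ≠ 0` excludes the empty set of maximizers, so the distance is attained
  have hne : (P.dualOpt ρ).Nonempty := by
    by_contra h
    rw [Set.not_nonempty_iff_eq_empty] at h
    simp [ConvexQP.Rd, h] at hR
  obtain ⟨y, hy, hyR⟩ := (ConvexQP.isClosed_dualOpt hρ.nonneg hU).exists_infDist_eq_dist hne 0
  rw [dist_zero_left] at hyR
  change P.Rd ρ 0 = ‖y‖ at hyR
  have hyd : P.Fstar ≤ P.dual ρ y := by
    obtain ⟨l, hl⟩ := hmult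
    exact (hl.Fstar_le_dual hρ.nonneg hU).trans (hy.2 l hl.mem_Kd)
  have hX2 : P.kOut ρ ε 0 ^ 2 = 8 * P.Ld ρ * P.Rd ρ 0 ^ 2 / ε := Real.sq_sqrt (by positivity)
  have hδ := ConvexQP.innerAcc_eq hε hL hR
  rw [hδ] at hrun
  set X := P.kOut ρ ε 0 with hX
  have hX0 : 0 < X := by linarith
  -- both roundings satisfy `X ≤ k + 1` and `k ≤ X + 1 ≤ 2 X`
  have hkX : 1 ≤ k ∧ X ≤ k + 1 ∧ (k : ℝ) ≤ 2 * X := by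
    rcases hk with rfl | rfl
    · exact ⟨(Nat.one_le_floor_iff _).2 hk1, (Nat.lt_floor_add_one X).le,
        by linarith [Nat.floor_le hX0.le]⟩
    · exact ⟨Nat.one_le_ceil_iff.2 hX0, by linarith [Nat.le_ceil X],
        by linarith [Nat.ceil_lt_add_one hX0.le]⟩
  obtain ⟨hk1', hXk, hkX⟩ := hkX
  have hδk : 2 * (ε / (4 * X)) * k ≤ ε := by
    calc 2 * (ε / (4 * X)) * k ≤ 2 * (ε / (4 * X)) * (2 * X) := by gcongr
      _ = ε := by field_simp; norm_num
  have hS : 4 * P.Ld ρ * ‖y‖ ^ 2 ≤ 2 * ε * nesterovTheta k ^ 2 := by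
    obtain ⟨m, rfl⟩ : ∃ m, k = m + 1 := ⟨k - 1, by omega⟩
    have h1 := le_nesterovTheta_succ m
    push_cast at hXk
    have h2 : (X / 2) ^ 2 ≤ nesterovTheta (m + 1) ^ 2 :=
      pow_le_pow_left₀ (by positivity) (by linarith) 2
    rw [eq_div_iff hε.ne'] at hX2
    rw [← hyR]
    nlinarith [mul_le_mul_of_nonneg_left h2 hε.le]
  obtain ⟨h1, h2, h3, h4⟩ := ConvexQP.thetaAverage_accuracy hρ hG hL hrun hfeas hk1'
    (by positivity) hδk hy.1 hyd (hyR ▸ hR) hS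
  refine ⟨h1, ?_, h3, by linarith⟩
  rw [le_div_iff₀ hR, hyR, mul_comm]
  exact h2
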